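/- Let $f_{\mathrm s}:\mathbb R^n\to\mathbb R^n$, $B\in\mathbb R^{n\times m}$, $\gamma,e_{\mathrm t}\in\mathbb R$. Let $\mathbb X\subset\mathbb R^n$ and $\mathbb U\subset\mathbb R^m$ be finite grids (Cartesian products of nonempty finite subsets of $\mathbb R$, each stored as an increasing list) with $X$ and $U$ points, $C_{\mathrm s}:\mathbb X\to\mathbb R$ and $C_{\mathrm i}:\mathbb U\to\mathbb R$ discrete costs, and $w_1,\dots,w_W\in\mathbb R^n$ ($W\ge1$) disturbances with weights $p_1,\dots,p_W$. Let $J\mapsto\widetilde J$ be an operator that extends discrete functions $J:\mathbb X\to\mathbb R$ to points of $\mathbb R^n$. For finite grids $\mathbb A,\mathbb D$ and $h:\mathbb A\to\mathbb R$, the discrete conjugate is $h^{*}(d)=\max_{a\in\mathbb A}\{\langle a,d\rangle-h(a)\}$, $d\in\mathbb D$, computed by the linear-time Legendre transform (LLT: lower convex hull and merging of slopes, one dimension after the other), and $\overline h$ denotes multilinear interpolation and extrapolation of $h$ (LERP: bisection in each dimension and a weighted sum over the vertices of the cell). The algorithm ConjVI is the following. Initialization: construct a grid $\mathbb V\subset\mathbb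 R^m$; compute $C_{\mathrm i}^{*}:\mathbb V\to\mathbb R$ by LLT; construct grids $\mathbb Z,\mathbb Y\subset\mathbb R^n$; set $J\leftarrow0$ and $J_+\leftarrow C_{\mathrm s}-\min C_{\mathrm i}$ on $\mathbb X$. Iteration: if $\|J_+-J\|_\infty< e_{\mathrm t}$, stop with output $J_+$. Otherwise set $J\leftarrow J_+$; compute $\varepsilon(x)=\gamma\sum_l p_l\,\widetilde J(x+w_l)$ for $x\in\mathbb X$; compute $\varepsilon^{*}$ on $\mathbb Y$ by LLT; compute $\varphi(y)=\overline{C_{\mathrm i}^{*}}(-B^{\top}y)+\varepsilon^{*}(y)$ for $y\in\mathbb Y$ by LERP; compute $\varphi^{*}$ on $\mathbb Z$ by LLT; and compute $J_+(x)=C_{\mathrm s}(x)+\overline{\varphi^{*}}(f_{\mathrm s}(x))$ for $x\in\mathbb X$ by LERP. Operations are counted on a random access machine with real numbers, on which an arithmetic operation, a comparison, or a memory access costs one. Theorem (complexity). Fix $n$, $m$ and a constant $K$. There is a constant $C$, depending only on $n,m,K$, such that the following holds for all data as above and every real $E\ge1$. Suppose that $\mathbb Y$ and $\mathbb Z$ have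 in each dimension as many points as $\mathbb X$, and $\mathbb V$ as many as $\mathbb U$ (so $Y=Z=X$ and $V=U$), that the construction of each of $\mathbb Y,\mathbb Z,\mathbb V$ takes at most $K(X+U)$ operations, that an evaluation of $f_{\mathrm s}$ takes at most $K$ operations, and that each evaluation $\widetilde J(x+w_l)$ of the extension operator takes at most $KE$ operations. Then ConjVI performs its initialization, correctly, in at most $C\,(X+U)$ operations, that is, in $O(X+U)$ operations, and each of its iterations, correctly, in at most $C\,XWE\log(X+U)$ operations, that is, in $\widetilde O(XWE)$ operations. -/

import Mathlib

/-! The value-iteration algorithm in the conjugate domain (ConjVI), written as a program on a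
random access machine with real registers, together with the formulas that it evaluates. -/

namespace ConjVI

/-! ## The machine: computations that count their elementary operations -/

/-- The outcome of a computation: its result and the number of elementary operations it used. -/
structure Timed (α : Type) where
  val : α
  cost : ℕ

namespace Timed

instance : Monad Timed where
  pure a := ⟨a, 0⟩
  bind x f := ⟨(f x.val).val, x.cost + (f x.val).cost⟩

/-- Charge `k` elementary operations (index arithmetic, branching, list manipulation). -/
def charge (k : ℕ) : Timed Unit := ⟨(), k⟩

/-- Read one entry of an array: one operation. -/
def rd {ι : Type} {α : ι → Type} (T : ∀ i, α i) (i : ι) : Timed (α i) := ⟨T i, 1⟩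

/-- Write one entry of an array: one operation. -/
def wr {ι α : Type} [DecidableEq ι] (T : ι → α) (i : ι) (a : α) : Timed (ι → α) :=
  ⟨Function.update T i a, 1⟩

/-- `for i do T(i) ← f(i)`: a loop that fills an array. It costs the sum of the costs of the bodies,
one further operation per pass (the write), and one operation to set the loop up. -/
def fill {ι : Type} {α : ι → Type} [Fintype ι] (f : ∀ i, Timed (α i)) : Timed (∀ i, α i) :=
  ⟨fun i => (f i).val, 1 + ∑ i, ((f i).cost + 1)⟩

/-- `for i in l do s ← f(s, i)`: a sequential loop, with one further operation per pass. -/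
def loop {ι σ : Type} (f : σ → ι → Timed σ) : List ι → σ → Timed σ
  | [], s => do
      charge 1
      return s
  | i :: l, s => do
      charge 1
      let s' ← f s i
      loop f l s'

end Timed

open Timed

/-- Scalars with unit-cost arithmetic and comparison. The programs below are written over an
abstract type of scalars with these operations only, so none of their arithmetic goes uncharged. -/
class Scalar (R : Type) where
  zero : R
  one : R
  add : R → R → Timed R
  sub : R → R → Timed R
  mul : R → R → Timed R
  div : R → R → Timed R
  /-- The test `a ≤ b`. -/
  le : R → R → Timed Bool

open scoped Classical in
/-- The real numbers as scalars: each operation is the usual one and costs one. -/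
noncomputable instance : Scalar ℝ where
  zero := 0
  one := 1
  add a b := ⟨a + b, 1⟩
  sub a b := ⟨a - b, 1⟩
  mul a b := ⟨a * b, 1⟩
  div a b := ⟨a / b, 1⟩
  le a b := ⟨decide (a ≤ b), 1⟩

/-- The coordinates of a grid with `N i` points in dimension `i`. The grid itself is the Cartesian
product of the sets `{g i 0, g i 1, …}`. -/
abbrev Coords (R : Type) {n : ℕ} (N : Fin n → ℕ) := ∀ i, Fin (N i) → R

/-- The points of a grid, by their multi-indices. -/
abbrev Idx {n : ℕ} (N : Fin n → ℕ) := ∀ i, Fin (N i)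

/-- A discrete function on a grid. -/
abbrev Tab (R : Type) {n : ℕ} (N : Fin n → ℕ) := Idx N → R

/-- The number of points of a grid. -/
def size {n : ℕ} (N : Fin n → ℕ) : ℕ := ∏ i, N i

section Programs

variable {R : Type} [Scalar R]

open Scalar

/-! ## Linear-time Legendre transform -/

/-- Put the point `p` on the stack `l` of vertices of a lower convex hull (the rightmost vertex on
top; `p` lies to the right of it): as long as the top `b` lies on or above the segment from the
vertex `a` below it to `p`, discard `b`. -/
def push (p : R × R) : List (R × R) → Timed (List (R × R))
  | b :: a :: l => do
      charge 1
      let dh₁ ← sub b.2 a.2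
      let dx₁ ← sub b.1 a.1
      let dh₂ ← sub p.2 b.2
      let dx₂ ← sub p.1 b.1
      let r₁ ← mul dh₂ dx₁
      let r₂ ← mul dh₁ dx₂
      let above ← le r₁ r₂
      if above then push p (a :: l) else return p :: b :: a :: l
  | l => do
      charge 1
      return p :: l

/-- The stack of vertices of the lower convex hull of the points `(x k, h k)`, for sorted `x`. -/
def hull {N : ℕ} (x h : Fin N → R) : Timed (List (R × R)) :=
  loop (fun l k => do
    let a ← rd x k
    let b ← rd h k
    push (a, b) l) (List.finRange N) []

/-- The value `s * x - h` at the point `q = (x, h)`. -/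
def gain (s : R) (q : R × R) : Timed R := do
  let t ← mul s q.1
  sub t q.2

/-- Walk down the hull to the left as long as the value of `s * x - h` does not decrease. -/
def advance (s : R) : List (R × R) → Timed (List (R × R))
  | b :: a :: l => do
      charge 1
      let vb ← gain s b
      let va ← gain s a
      let better ← le vb va
      if better then advance s (a :: l) else return b :: a :: l
  | l => do
      charge 1
      return l

/-- The value of `s * x - h` at the top of the stack. -/
def topGain (s : R) : List (R × R) → Timed R
  | [] => return zero
  | q :: _ => gain s q

/-- Linear-time Legendre transform in dimension one: from `h` on the sorted points `x`, compute
`max over k of s j * x k - h k` for the sorted slopes `s j`. The slopes are processed from the largest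
to the smallest one, while the maximizer moves along the hull from the right to the left. -/
def llt₁ {N M : ℕ} (x : Fin N → R) (s : Fin M → R) (h : Fin N → R) : Timed (Fin M → R) := do
  let l ← hull x h
  let out ← fill (fun _ : Fin M => (return zero : Timed R))
  let res ← loop (fun (st : List (R × R) × (Fin M → R)) j => do
    let sj ← rd s j
    let l' ← advance sj st.1
    let v ← topGain sj l'
    let out' ← wr st.2 j v
    return (l', out')) (List.finRange M).reverse (l, out)
  return res.2

variable {n : ℕ} {N : Fin n → ℕ}

/-- Change the sign of a table. -/
def negTab (T : Tab R N) : Timed (Tab R N) :=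
  fill (fun k => do
    let t ← rd T k
    sub zero t)

/-- Apply the one-dimensional transform along dimension `i`, on every line of the table `T` in that
direction. A line is given by the remaining entries of the multi-index. -/
def lltDim (x y : Coords R N) (i : Fin n) (T : Tab R N) : Timed (Tab R N) := do
  let L ← fill (fun r : (∀ j : {j // j ≠ i}, Fin (N j)) =>
    llt₁ (x i) (y i) (fun k => T ((Equiv.piSplitAt i (fun j => Fin (N j))).symm (k, r))))
  return fun k => L (fun j => k j) (k i)

/-- Linear-time Legendre transform: from the discrete function `h` on the grid `x`, compute its
discrete conjugate on the grid `y`, one dimension after the other, with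
`h*(y) = max_{x_1} (x_1 y_1 + max_{x_2} (x_2 y_2 + ⋯ - h(x)))`. -/
def llt (x y : Coords R N) (h : Tab R N) : Timed (Tab R N) := do
  let A ← negTab h
  loop (fun A i => do
    let T ← negTab A
    lltDim x y i T) (List.finRange n) A

/-! ## Multilinear interpolation and extrapolation -/

/-- Bisection on the sorted array `c`, between the positions `lo` and `hi`. -/
def bisect {N : ℕ} (c : Fin N → R) (t : R) (lo hi : Fin N) : Timed (Fin N × Fin N) :=
  if h : lo.val + 1 < hi.val then do
    charge 2
    let mid : Fin N := ⟨(lo.val + hi.val) / 2, by omega⟩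
    let a ← rd c mid
    let b ← le a t
    if b then bisect c t mid hi else bisect c t lo mid
  else do
    charge 1
    return (lo, hi)
termination_by hi.val - lo.val
decreasing_by all_goals omega

/-- The cell `[c lo, c hi]` of the sorted array `c` to be used at `t`, and the relative position of
`t` with respect to it (`0` if `c` consists of one point). -/
def locate {N : ℕ} [NeZero N] (c : Fin N → R) (t : R) : Timed ((Fin N × Fin N) × R) := do
  let b ← bisect c t 0 ⟨N - 1, Nat.sub_one_lt (NeZero.ne N)⟩
  charge 1
  if b.1 = b.2 then return (b, zero) else
    let a₁ ← rd c b.1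
    let a₂ ← rd c b.2
    let num ← sub t a₁
    let den ← sub a₂ a₁
    let r ← div num den
    return (b, r)

/-- Multilinear interpolation and extrapolation (LERP) of the discrete function `T` on the grid `g`,
evaluated at the point `q`. -/
noncomputable def lerp [∀ i, NeZero (N i)] (g : Coords R N) (T : Tab R N) (q : Fin n → R) :
    Timed R := do
  let cell ← fill (fun i => do
    let t ← rd q i
    locate (g i) t)
  loop (fun s (v : Fin n → Bool) => do
    let wt ← loop (fun a i => do
      let e ← rd cell i
      charge 1
      if v i then mul a e.2 else do
        let d ← sub one e.2
        mul a d) (List.finRange n) one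
    let t ← rd T (fun i => if v i then (cell i).1.2 else (cell i).1.1)
    let term ← mul wt t
    add s term) Finset.univ.toList zero

/-! ## The algorithm -/

variable {m : ℕ} {M : Fin m → ℕ} {W : ℕ}

/-- The input of the algorithm, with `N` and `M` the numbers of points of the discrete state space and
of the discrete input space in each dimension, and `W` the number of disturbances. -/
structure Input (R : Type) {n m : ℕ} (N : Fin n → ℕ) (M : Fin m → ℕ) (W : ℕ) where
  /-- coordinates of the discrete state space -/
  x : Coords R N
  /-- coordinates of the discrete input space -/
  u : Coords R M
  /-- evaluation of the map `f_s` of the dynamics `x⁺ = f_s(x) + B u + w` -/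
  fs : (Fin n → R) → Timed (Fin n → R)
  /-- the input matrix -/
  B : Matrix (Fin n) (Fin m) R
  /-- state cost on the discrete state space -/
  Cs : Tab R N
  /-- input cost on the discrete input space -/
  Ci : Tab R M
  /-- support of the disturbance -/
  w : Fin W → Fin n → R
  /-- probability mass function of the disturbance -/
  p : Fin W → R
  /-- discount factor -/
  γ : R
  /-- termination bound -/
  et : R
  /-- extension operator: evaluation at a point of the extension of a discrete function -/
  ext : Tab R N → (Fin n → R) → Timed R
  /-- construction of the state dual grid -/
  mkY : Timed (Coords R N)
  /-- construction of the grid for the second conjugation -/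
  mkZ : Timed (Coords R N)
  /-- construction of the input dual grid -/
  mkV : Timed (Coords R M)

/-- The objects that the initialization computes once and for all. -/
structure Setup (R : Type) {n m : ℕ} (N : Fin n → ℕ) (M : Fin m → ℕ) where
  Y : Coords R N
  Z : Coords R N
  V : Coords R M
  /-- the discrete conjugate of the input cost, on the grid `V` -/
  CiConj : Tab R M

/-- The variables of the main loop: two consecutive discrete value functions. -/
structure LoopState (R : Type) {n : ℕ} (N : Fin n → ℕ) where
  J : Tab R N
  Jplus : Tab R N

/-- The smallest entry of a nonempty table. -/
noncomputable def minTab [∀ i, NeZero (N i)] (T : Tab R N) : Timed R := do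
  let a ← rd T (fun _ => 0)
  loop (fun s k => do
    let t ← rd T k
    let b ← le t s
    if b then return t else return s) Finset.univ.toList a

/-- The infinity-norm of the difference of two tables. -/
noncomputable def distTab (S T : Tab R N) : Timed R :=
  loop (fun s k => do
    let a ← rd S k
    let b ← rd T k
    let d ← sub a b
    let d' ← sub b a
    let c ← le s d
    let s₁ ← (if c then return d else return s : Timed R)
    let c' ← le s₁ d'
    if c' then return d' else return s₁) Finset.univ.toList zero

/-- The initialization of the algorithm. -/
noncomputable def initialization [∀ j, NeZero (M j)] (I : Input R N M W) :
    Timed (Setup R N M × LoopState R N) := do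
  let V ← I.mkV
  let CiConj ← llt I.u V I.Ci
  let Z ← I.mkZ
  let Y ← I.mkY
  let J ← fill (fun _ : Idx N => (return zero : Timed R))
  let μ ← minTab I.Ci
  let Jplus ← fill (fun k => do
    let c ← rd I.Cs k
    sub c μ)
  return (⟨Y, Z, V, CiConj⟩, ⟨J, Jplus⟩)

/-- The scaled expectation filter `ε(x) ← γ · ∑ w, p(w) · [extension of J](x + w)`. -/
def expectation (I : Input R N M W) (J : Tab R N) : Timed (Tab R N) :=
  fill (fun k => do
    let s ← loop (fun s l => do
      let q ← fill (fun i => do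
        let a ← rd (I.x i) (k i)
        let b ← rd (I.w l) i
        add a b)
      let e ← I.ext J q
      let pl ← rd I.p l
      let t ← mul pl e
      add s t) (List.finRange W) zero
    mul I.γ s)

/-- The point `-Bᵀ y`. -/
def negTransposeMul (B : Matrix (Fin n) (Fin m) R) (y : Fin n → R) : Timed (Fin m → R) :=
  fill (fun j => loop (fun s i => do
    let b ← rd (B i) j
    let a ← rd y i
    let t ← mul b a
    sub s t) (List.finRange n) zero)

/-- The point of a grid with a given multi-index. -/
def pointAt (g : Coords R N) (k : Idx N) : Timed (Fin n → R) :=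
  fill (fun i => rd (g i) (k i))

/-- The body of the main loop: `J ← J₊`, followed by the discrete conjugate DP operation. -/
noncomputable def body [∀ i, NeZero (N i)] [∀ j, NeZero (M j)] (I : Input R N M W) (S : Setup R N M)
    (st : LoopState R N) : Timed (LoopState R N) := do
  let J ← fill (fun k => rd st.Jplus k)
  let ε ← expectation I J
  let εConj ← llt I.x S.Y ε
  let φ ← fill (fun k => do
    let y ← pointAt S.Y k
    let v ← negTransposeMul I.B y
    let c ← lerp S.V S.CiConj v
    let e ← rd εConj k
    add c e)
  let φConj ← llt S.Y S.Z φ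
  let Jplus ← fill (fun k => do
    let x ← pointAt I.x k
    let z ← I.fs x
    let t ← lerp S.Z φConj z
    let c ← rd I.Cs k
    add c t)
  return ⟨J, Jplus⟩

/-- One iteration of the main loop: if `‖J₊ - J‖ ≥ e_t`, then execute the body of the loop and continue
with the new loop variables (`Sum.inl`), else stop with the output `J₊` (`Sum.inr`). -/
noncomputable def iteration [∀ i, NeZero (N i)] [∀ j, NeZero (M j)] (I : Input R N M W)
    (S : Setup R N M) (st : LoopState R N) : Timed (LoopState R N ⊕ Tab R N) := do
  let d ← distTab st.Jplus st.J
  let b ← le I.et d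
  if b then do
    let st' ← body I S st
    return Sum.inl st'
  else return Sum.inr st.Jplus

end Programs

/-! ## The formulas that the algorithm evaluates -/

variable {n m : ℕ} {N : Fin n → ℕ} {M : Fin m → ℕ} {W : ℕ}

/-- The discrete conjugate on the grid `y` of the discrete function `h` on the grid `x`. -/
noncomputable def conj [∀ i, NeZero (N i)] (x y : Coords ℝ N) (h : Tab ℝ N) : Tab ℝ N := fun j =>
  Finset.univ.sup' Finset.univ_nonempty (fun k : Idx N => (∑ i, x i (k i) * y i (j i)) - h k)

/-- The index of the left end of the cell of the sorted array `c` that is used at `t`: the number of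
interior nodes of `c` that are at most `t`. This is the cell that contains `t`, or the first or last
cell if `t` is out of range. -/
noncomputable def cellIdx {K : ℕ} (c : Fin K → ℝ) (t : ℝ) : ℕ :=
  {k : Fin K | 0 < k.val ∧ k.val + 1 < K ∧ c k ≤ t}.ncard

/-- The left end of the cell used at `t`. -/
noncomputable def cellLo {K : ℕ} [NeZero K] (c : Fin K → ℝ) (t : ℝ) : Fin K :=
  ⟨min (cellIdx c t) (K - 1), lt_of_le_of_lt (min_le_right _ _) (Nat.sub_one_lt (NeZero.ne K))⟩

/-- The right end of the cell used at `t`; it is the left end if `c` consists of one point. -/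
noncomputable def cellHi {K : ℕ} [NeZero K] (c : Fin K → ℝ) (t : ℝ) : Fin K :=
  ⟨min (cellIdx c t + 1) (K - 1), lt_of_le_of_lt (min_le_right _ _) (Nat.sub_one_lt (NeZero.ne K))⟩

/-- The relative position of `t` in its cell (`0` if `c` consists of one point). -/
noncomputable def cellPos {K : ℕ} [NeZero K] (c : Fin K → ℝ) (t : ℝ) : ℝ :=
  (t - c (cellLo c t)) / (c (cellHi c t) - c (cellLo c t))

/-- The multilinear interpolation and extrapolation at `q` of the discrete function `T` on the grid `g`:
a sum over the vertices of the cell used at `q`. -/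
noncomputable def LERP [∀ i, NeZero (N i)] (g : Coords ℝ N) (T : Tab ℝ N) (q : Fin n → ℝ) : ℝ :=
  ∑ v : Fin n → Bool,
    (∏ i, if v i then cellPos (g i) (q i) else 1 - cellPos (g i) (q i)) *
      T (fun i => if v i then cellHi (g i) (q i) else cellLo (g i) (q i))

/-- The discrete conjugate DP operator, for given grids `Y`, `Z`, `V`. -/
noncomputable def dCDP [∀ i, NeZero (N i)] [∀ j, NeZero (M j)] (I : Input ℝ N M W)
    (Y Z : Coords ℝ N) (V : Coords ℝ M) (J : Tab ℝ N) : Tab ℝ N :=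
  let ε : Tab ℝ N := fun k => I.γ * ∑ l, I.p l * (I.ext J (fun i => I.x i (k i) + I.w l i)).val
  let φ : Tab ℝ N := fun k =>
    LERP V (conj I.u V I.Ci) (-(I.B.transpose.mulVec (fun i => Y i (k i)))) + conj I.x Y ε k
  fun k => I.Cs k + LERP Z (conj Y Z φ) (I.fs (fun i => I.x i (k i))).val

/-- The result of the initialization: the grids, the discrete conjugate of the input cost, and the
discrete functions `0` and `C_s - min C_i`. -/
noncomputable def initialData [∀ j, NeZero (M j)] (I : Input ℝ N M W) :
    Setup ℝ N M × LoopState ℝ N :=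
  (⟨I.mkY.val, I.mkZ.val, I.mkV.val, conj I.u I.mkV.val I.Ci⟩,
    ⟨fun _ => 0, fun k => I.Cs k - Finset.univ.inf' Finset.univ_nonempty I.Ci⟩)

/-- The coordinates are listed in increasing order, without repetition, in each dimension. -/
def Sorted (g : Coords ℝ N) : Prop := ∀ i, StrictMono (g i)

end ConjVI

/-!
The algorithm is a composition of passes over tables, so the value and the cost of each pass can be
determined separately; logarithms enter only through bisection.

*Transform in dimension one.* The stack built by `hull` is convex in the sense of `Peaked`, and
every slope attains its maximum over the given points on it (`Covers`), because a vertex on or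
above the segment between its neighbours is never strictly better than both (`gainVal_le_or_le`). On
a convex stack the values at a fixed slope increase and then decrease, so `advance` stops at a
maximizer; the vertices it discards are not needed for smaller slopes, since a decrease of the slope
favours points further to the left (`advance_spec`). Each vertex is put on a stack once and removed
at most once; with the length of the stack as potential (`cost_loop_add_le`), the amortized cost of
each pass is bounded, and the transform is linear in the number of points and slopes
(`cost_llt₁_le`).

*Several dimensions.* After some dimensions have been processed, the table holds the maximum over
the corresponding entries of the multi-index (`isGreatest_foldl_lltDim`); at the end this is the
discrete conjugate. The lines in one direction partition the grid, so that each dimension costs a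
multiple of the number of grid points (`cost_llt_le`).

*Interpolation.* Bisection keeps its lower end at most `t` and its upper end above `t`, except at
the ends of the array; hence it finds the cell given by the count of the interior nodes that are at
most `t` (`val_bisect`), and `k` halvings suffice for at most `2 ^ k` nodes. A sum over the `2 ^ n`
vertices of the cell follows, a constant number for fixed `n` (`cost_lerp_le`).

Adding up, an iteration costs at most `X (c₁ W E + c₂ k + c₃)` with `X = size N` and `k` one more
than the binary logarithm of `X + U`. Since `X + U ≥ 2`, both `k` and `1` are bounded by multiples
of `log (X + U)`, which gives the claim.
-/

namespace ConjVI

open Timed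

/-! ### Values and costs of timed computations -/

namespace Timed

variable {α β ι σ : Type}

@[simp] lemma val_pure (a : α) : (pure a : Timed α).val = a := rfl

@[simp] lemma cost_pure (a : α) : (pure a : Timed α).cost = 0 := rfl

@[simp] lemma val_bind (x : Timed α) (f : α → Timed β) : (x >>= f).val = (f x.val).val := rfl

@[simp] lemma cost_bind (x : Timed α) (f : α → Timed β) :
    (x >>= f).cost = x.cost + (f x.val).cost := rfl

@[simp] lemma cost_charge (k : ℕ) : (charge k).cost = k := rfl

@[simp] lemma val_rd {α : ι → Type} (T : ∀ i, α i) (i : ι) : (rd T i).val = T i := rfl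

@[simp] lemma cost_rd {α : ι → Type} (T : ∀ i, α i) (i : ι) : (rd T i).cost = 1 := rfl

@[simp] lemma cost_wr [DecidableEq ι] (T : ι → α) (i : ι) (a : α) : (wr T i a).cost = 1 := rfl

@[simp] lemma val_fill {α : ι → Type} [Fintype ι] (f : ∀ i, Timed (α i)) :
    (fill f).val = fun i => (f i).val := rfl

lemma cost_fill_le {α : ι → Type} [Fintype ι] (f : ∀ i, Timed (α i)) (c : ℕ)
    (h : ∀ i, (f i).cost ≤ c) : (fill f).cost ≤ 1 + Fintype.card ι * (c + 1) := by
  have : ∑ i, ((f i).cost + 1) ≤ ∑ _i : ι, (c + 1) :=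
    Finset.sum_le_sum fun i _ => Nat.succ_le_succ (h i)
  simpa [fill] using this

lemma val_loop (f : σ → ι → Timed σ) (l : List ι) (s : σ) :
    (loop f l s).val = l.foldl (fun s i => (f s i).val) s := by
  induction l generalizing s with
  | nil => rfl
  | cons i l ih => simp [loop, ih]

/-- The potential method for loops: the amortized cost of each pass is at most `c`. -/
lemma cost_loop_add_le (f : σ → ι → Timed σ) (Φ : σ → ℕ) (c : ℕ)
    (h : ∀ s i, (f s i).cost + Φ (f s i).val ≤ Φ s + c) (l : List ι) (s : σ) :
    (loop f l s).cost + Φ (loop f l s).val ≤ Φ s + l.length * (c + 1) + 1 := by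
  induction l generalizing s with
  | nil => simp [loop]; omega
  | cons i l ih =>
    have h₁ := h s i
    have h₂ := ih (f s i).val
    simp only [loop, cost_bind, cost_charge, val_bind, List.length_cons, add_mul]
    omega

lemma cost_loop_le (f : σ → ι → Timed σ) (c : ℕ) (h : ∀ s i, (f s i).cost ≤ c) (l : List ι)
    (s : σ) : (loop f l s).cost ≤ l.length * (c + 1) + 1 := by
  simpa using cost_loop_add_le f (fun _ => 0) c (by simpa using h) l s

end Timed

namespace Scalar

@[simp] lemma zero_real : (zero : ℝ) = 0 := rfl

@[simp] lemma one_real : (one : ℝ) = 1 := rfl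

@[simp] lemma add_real (a b : ℝ) : add a b = ⟨a + b, 1⟩ := rfl

@[simp] lemma sub_real (a b : ℝ) : sub a b = ⟨a - b, 1⟩ := rfl

@[simp] lemma mul_real (a b : ℝ) : mul a b = ⟨a * b, 1⟩ := rfl

@[simp] lemma div_real (a b : ℝ) : div a b = ⟨a / b, 1⟩ := rfl

@[simp] lemma cost_le_real (a b : ℝ) : (le a b).cost = 1 := rfl

@[simp] lemma val_le_real (a b : ℝ) : (le a b).val = true ↔ a ≤ b := by simp [le]

end Scalar

/-! ### Lower convex hulls and the transform in dimension one -/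

/-- The value at the slope `s` of the affine function that the point `q` contributes to a discrete
conjugate. -/
def gainVal (s : ℝ) (q : ℝ × ℝ) : ℝ := s * q.1 - q.2

@[simp] lemma val_gain (s : ℝ) (q : ℝ × ℝ) : (gain s q).val = gainVal s q := rfl

@[simp] lemma cost_gain (s : ℝ) (q : ℝ × ℝ) : (gain s q).cost = 2 := rfl

/-- Convexity of a stack of hull vertices (rightmost vertex on top), in the form used by the walk
along the hull: for every slope, once the value drops from one vertex to the next one to the left,
no vertex further to the left exceeds it. -/
def Peaked : List (ℝ × ℝ) → Prop
  | b :: a :: l => a.1 < b.1 ∧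
      (∀ s, gainVal s a < gainVal s b → ∀ c ∈ l, gainVal s c ≤ gainVal s b) ∧ Peaked (a :: l)
  | _ => True

/-- Every slope finds in `l` a value as large as the one at `q`. -/
def Covers (l : List (ℝ × ℝ)) (q : ℝ × ℝ) : Prop := ∀ s, ∃ r ∈ l, gainVal s q ≤ gainVal s r

lemma Covers.of_mem {l : List (ℝ × ℝ)} {q : ℝ × ℝ} (h : q ∈ l) : Covers l q :=
  fun _ => ⟨q, h, le_rfl⟩

lemma Covers.trans {l l' : List (ℝ × ℝ)} {q : ℝ × ℝ} (h : Covers l q)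
    (h' : ∀ r ∈ l, Covers l' r) : Covers l' q := fun s => by
  obtain ⟨r, hr, h₁⟩ := h s
  obtain ⟨r', hr', h₂⟩ := h' r hr s
  exact ⟨r', hr', h₁.trans h₂⟩

lemma push_cons_cons (p b a : ℝ × ℝ) (l : List (ℝ × ℝ)) :
    (push p (b :: a :: l)).val =
      if (p.2 - b.2) * (b.1 - a.1) ≤ (b.2 - a.2) * (p.1 - b.1) then (push p (a :: l)).val
      else p :: b :: a :: l := by
  rw [push]
  by_cases h : (p.2 - b.2) * (b.1 - a.1) ≤ (b.2 - a.2) * (p.1 - b.1) <;>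
    simp [h]

/-- Eight operations pay for the removal of a vertex, and a vertex is put on the stack once. -/
lemma cost_push_le (p : ℝ × ℝ) : ∀ l : List (ℝ × ℝ),
    (push p l).cost + 8 * (push p l).val.length ≤ 8 * l.length + 16
  | [] => by simp [push]
  | [b] => by simp [push]
  | b :: a :: l => by
    have ih := cost_push_le p (a :: l)
    rw [push_cons_cons, push]
    by_cases h : (p.2 - b.2) * (b.1 - a.1) ≤ (b.2 - a.2) * (p.1 - b.1)
    · simp [h] at ih ⊢; omega
    · simp [h]; omega

lemma push_subset (p : ℝ × ℝ) : ∀ l : List (ℝ × ℝ), (push p l).val ⊆ p :: l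
  | [] => by simp [push]
  | [b] => by simp [push]
  | b :: a :: l => by
    have ih := push_subset p (a :: l)
    rw [push_cons_cons]
    split_ifs
    · exact List.Subset.trans ih (List.cons_subset_cons _ (List.subset_cons_self _ _))
    · exact List.Subset.refl _

lemma peaked_push (p : ℝ × ℝ) : ∀ l : List (ℝ × ℝ), Peaked l → (∀ b ∈ l, b.1 < p.1) →
    Peaked (push p l).val
  | [], _, _ => by simp [push, Peaked]
  | [b], _, h => by simpa [push, Peaked] using h
  | b :: a :: l, hl, h => by
    rw [push_cons_cons]
    split_ifs with hc
    · exact peaked_push p (a :: l) hl.2.2 fun q hq => h q (List.mem_cons_of_mem _ hq)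
    · refine ⟨h b (by simp), fun s hs => ?_, hl⟩
      have hab := hl.1
      have hbp := h b (by simp)
      simp only [gainVal] at hs
      -- `s` exceeds the slope of the edge from `b` to `p`, hence that of the one from `a` to `b`
      have hsab : gainVal s a < gainVal s b := by
        simp only [gainVal]
        have h₁ : (b.2 - a.2) * (p.1 - b.1) < s * (b.1 - a.1) * (p.1 - b.1) := by
          have : (p.2 - b.2) * (b.1 - a.1) < s * (p.1 - b.1) * (b.1 - a.1) :=
            mul_lt_mul_of_pos_right (by linarith) (by linarith)
          linarith
        have := lt_of_mul_lt_mul_right h₁ (by linarith)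
        linarith
      intro c hcl
      rcases List.mem_cons.1 hcl with rfl | hcl
      · exact hsab.le.trans (by simpa only [gainVal] using hs.le)
      · exact (hl.2.1 s hsab c hcl).trans (by simpa only [gainVal] using hs.le)

/-- A vertex on or above a segment is not needed for any slope. -/
lemma gainVal_le_or_le {a b p : ℝ × ℝ} (hab : a.1 < b.1) (hbp : b.1 < p.1)
    (h : (p.2 - b.2) * (b.1 - a.1) ≤ (b.2 - a.2) * (p.1 - b.1)) (s : ℝ) :
    gainVal s b ≤ gainVal s a ∨ gainVal s b ≤ gainVal s p := by
  by_contra! hc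
  simp only [gainVal] at hc
  have h₁ : (b.2 - a.2) * (p.1 - b.1) < s * (b.1 - a.1) * (p.1 - b.1) :=
    mul_lt_mul_of_pos_right (by linarith) (by linarith)
  have h₂ : s * (p.1 - b.1) * (b.1 - a.1) < (p.2 - b.2) * (b.1 - a.1) :=
    mul_lt_mul_of_pos_right (by linarith) (by linarith)
  linarith

lemma covers_push (p : ℝ × ℝ) : ∀ l : List (ℝ × ℝ), Peaked l → (∀ b ∈ l, b.1 < p.1) →
    ∀ q ∈ p :: l, Covers (push p l).val q
  | [], _, _, q, hq => .of_mem (by simpa [push] using hq)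
  | [b], _, _, q, hq => .of_mem (by simpa [push] using hq)
  | b :: a :: l, hl, h, q, hq => by
    rw [push_cons_cons]
    split_ifs with hc
    · have ih := covers_push p (a :: l) hl.2.2 fun q hq => h q (List.mem_cons_of_mem _ hq)
      rcases List.mem_cons.1 hq with rfl | hq
      · exact ih _ (by simp)
      rcases List.mem_cons.1 hq with rfl | hq
      · intro s
        rcases gainVal_le_or_le hl.1 (h q (by simp)) hc s with h' | h'
        · obtain ⟨r, hr, h₁⟩ := ih a (by simp) s
          exact ⟨r, hr, h'.trans h₁⟩
        · obtain ⟨r, hr, h₁⟩ := ih p (by simp) s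
          exact ⟨r, hr, h'.trans h₁⟩
      · exact ih q (List.mem_cons_of_mem _ hq)
    · exact .of_mem hq

/-- Invariant of the construction of the hull: processing the points with indices `ks`, to the right
of the stack `l`. -/
lemma foldl_push {N : ℕ} (x h : Fin N → ℝ) (ks : List (Fin N)) (l : List (ℝ × ℝ)) (hl : Peaked l)
    (hx : ks.Pairwise fun i j => x i < x j) (hlx : ∀ b ∈ l, ∀ k ∈ ks, b.1 < x k) :
    let l' := ks.foldl (fun l k => (push (x k, h k) l).val) l
    Peaked l' ∧ (∀ q ∈ l', q ∈ l ∨ ∃ k, q = (x k, h k)) ∧ (∀ q ∈ l, Covers l' q) ∧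
      ∀ k ∈ ks, Covers l' (x k, h k) := by
  induction ks generalizing l with
  | nil => exact ⟨hl, fun q hq => .inl hq, fun q hq => .of_mem hq, by simp⟩
  | cons k ks ih =>
    have hlk : ∀ b ∈ l, b.1 < x k := fun b hb => hlx b hb k (by simp)
    rw [List.pairwise_cons] at hx
    have hc := covers_push (x k, h k) l hl hlk
    have hs := push_subset (x k, h k) l
    obtain ⟨h₁, h₂, h₃, h₄⟩ := ih (push (x k, h k) l).val (peaked_push _ l hl hlk) hx.2 (by
      intro b hb j hj
      rcases List.mem_cons.1 (hs hb) with rfl | hb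
      · exact hx.1 j hj
      · exact hlx b hb j (by simp [hj]))
    refine ⟨h₁, fun q hq => ?_, fun q hq => (hc q (by simp [hq])).trans h₃, fun j hj => ?_⟩
    · rcases h₂ q hq with hq | hq
      · rcases List.mem_cons.1 (hs hq) with rfl | hq
        exacts [.inr ⟨k, rfl⟩, .inl hq]
      · exact .inr hq
    · rcases List.mem_cons.1 hj with rfl | hj
      exacts [(hc _ (by simp)).trans h₃, h₄ j hj]

lemma hull_spec {N : ℕ} {x : Fin N → ℝ} (h : Fin N → ℝ) (hx : StrictMono x) :
    Peaked (hull x h).val ∧ (∀ q ∈ (hull x h).val, ∃ k, q = (x k, h k)) ∧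
      ∀ k, Covers (hull x h).val (x k, h k) := by
  have hp : (List.finRange N).Pairwise fun i j => x i < x j :=
    (List.pairwise_lt_finRange N).imp fun hij => hx hij
  obtain ⟨h₁, h₂, -, h₄⟩ := foldl_push x h (List.finRange N) [] trivial hp (by simp)
  rw [hull, val_loop]
  exact ⟨h₁, fun q hq => by simpa using h₂ q hq, fun k => h₄ k (List.mem_finRange k)⟩

lemma cost_hull_le {N : ℕ} (x h : Fin N → ℝ) :
    (hull x h).cost + 8 * (hull x h).val.length ≤ 19 * N + 1 := by
  refine (cost_loop_add_le _ (fun l : List (ℝ × ℝ) => 8 * l.length) 18 (fun l k => ?_) _ _).trans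
    (by simp; omega)
  have := cost_push_le (x k, h k) l
  simp only [cost_bind, cost_rd, val_rd, val_bind]
  omega

lemma advance_cons_cons (s : ℝ) (b a : ℝ × ℝ) (l : List (ℝ × ℝ)) :
    (advance s (b :: a :: l)).val =
      if gainVal s b ≤ gainVal s a then (advance s (a :: l)).val else b :: a :: l := by
  rw [advance]
  by_cases h : gainVal s b ≤ gainVal s a <;> simp [h]

lemma cost_advance_le (s : ℝ) : ∀ l : List (ℝ × ℝ),
    (advance s l).cost + 6 * (advance s l).val.length ≤ 6 * l.length + 6
  | [] => by simp [advance]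
  | [b] => by simp [advance]
  | b :: a :: l => by
    have ih := cost_advance_le s (a :: l)
    rw [advance_cons_cons, advance]
    by_cases h : gainVal s b ≤ gainVal s a
    · simp [h] at ih ⊢; omega
    · simp [h]; omega

/-- Walking along the hull for the slope `s` brings a maximizer for `s` to the top, and discards no
vertex that a smaller slope needs. -/
lemma advance_spec (s : ℝ) : ∀ l : List (ℝ × ℝ), Peaked l → l ≠ [] →
    Peaked (advance s l).val ∧ (advance s l).val ⊆ l ∧
      (∀ s' ≤ s, ∀ q ∈ l, ∃ r ∈ (advance s l).val, gainVal s' q ≤ gainVal s' r) ∧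
      ∃ b l', (advance s l).val = b :: l' ∧ ∀ q ∈ (advance s l).val, gainVal s q ≤ gainVal s b
  | [], _, h => absurd rfl h
  | [b], hl, _ => by simp [advance, Peaked]
  | b :: a :: l, hl, _ => by
    rw [advance_cons_cons]
    split_ifs with hc
    · obtain ⟨h₁, h₂, h₃, h₄⟩ := advance_spec s (a :: l) hl.2.2 (by simp)
      refine ⟨h₁, List.Subset.trans h₂ (List.subset_cons_self _ _), fun s' hs' q hq => ?_, h₄⟩
      rcases List.mem_cons.1 hq with rfl | hq
      · obtain ⟨r, hr, h'⟩ := h₃ s' hs' a (by simp)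
        refine ⟨r, hr, le_trans ?_ h'⟩
        have := mul_le_mul_of_nonneg_right hs' (sub_nonneg.2 hl.1.le)
        simp only [gainVal] at hc ⊢
        linarith
      · exact h₃ s' hs' q hq
    · refine ⟨hl, List.Subset.refl _, fun s' _ q hq => ⟨q, hq, le_rfl⟩, b, a :: l, rfl, ?_⟩
      rw [not_le] at hc
      intro q hq
      rcases List.mem_cons.1 hq with rfl | hq
      · exact le_rfl
      rcases List.mem_cons.1 hq with rfl | hq
      · exact hc.le
      · exact hl.2.1 s hc q hq

/-- One pass of the second half of the transform: the stack of candidates and the output table. -/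
noncomputable def slopeStep {M : ℕ} (s : Fin M → ℝ) (st : List (ℝ × ℝ) × (Fin M → ℝ)) (j : Fin M) :
    List (ℝ × ℝ) × (Fin M → ℝ) :=
  ((advance (s j) st.1).val,
    Function.update st.2 j (topGain (s j) (advance (s j) st.1).val).val)

/-- Invariant of the second half of the transform, for the set `S` of all points and slopes with
decreasing indices `js`: the stack still covers `S` for all slopes to come. -/
lemma foldl_slopeStep {M : ℕ} (s : Fin M → ℝ) (S : Set (ℝ × ℝ)) (hS : S.Nonempty)
    (js : List (Fin M)) (hjs : js.Pairwise fun i j => s j < s i) (l : List (ℝ × ℝ))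
    (out : Fin M → ℝ) (hl : Peaked l) (hlS : ∀ q ∈ l, q ∈ S)
    (hSl : ∀ j ∈ js, ∀ q ∈ S, ∃ r ∈ l, gainVal (s j) q ≤ gainVal (s j) r) :
    (∀ j ∈ js, IsGreatest (gainVal (s j) '' S) ((js.foldl (slopeStep s) (l, out)).2 j)) ∧
      ∀ j ∉ js, (js.foldl (slopeStep s) (l, out)).2 j = out j := by
  induction js generalizing l out with
  | nil => simp
  | cons j js ih =>
    rw [List.pairwise_cons] at hjs
    have hne : l ≠ [] := by
      rintro rfl
      obtain ⟨q, hq⟩ := hS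
      simpa using hSl j (by simp) q hq
    obtain ⟨h₁, h₂, h₃, b, l', hb, hmax⟩ := advance_spec (s j) l hl hne
    obtain ⟨ih₁, ih₂⟩ := ih hjs.2 (advance (s j) l).val (slopeStep s (l, out) j).2 h₁
      (fun q hq => hlS q (h₂ hq)) (by
        intro i hi q hq
        obtain ⟨r, hr, hqr⟩ := hSl i (by simp [hi]) q hq
        obtain ⟨r', hr', hrr⟩ := h₃ (s i) (hjs.1 i hi).le r hr
        exact ⟨r', hr', hqr.trans hrr⟩)
    rw [List.foldl_cons]
    have hjn : j ∉ js := fun hj => lt_irrefl _ (hjs.1 j hj)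
    refine ⟨fun i hi => ?_, fun i hi => ?_⟩
    · rcases List.mem_cons.1 hi with rfl | hi
      · have hv : (slopeStep s (l, out) i).2 i = gainVal (s i) b := by simp [slopeStep, hb, topGain]
        have := ih₂ i hjn
        change IsGreatest _
          ((js.foldl (slopeStep s) ((advance (s i) l).val, (slopeStep s (l, out) i).2)).2 i)
        rw [this, hv]
        refine ⟨⟨b, hlS b (h₂ (by simp [hb])), rfl⟩, ?_⟩
        rintro _ ⟨q, hq, rfl⟩
        obtain ⟨r, hr, hqr⟩ := hSl i (by simp) q hq
        obtain ⟨r', hr', hrr⟩ := h₃ (s i) le_rfl r hr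
        exact hqr.trans (hrr.trans (hmax r' hr'))
      · exact ih₁ i hi
    · rw [List.mem_cons, not_or] at hi
      refine (ih₂ i hi.2).trans ?_
      simp [slopeStep, hi.1]

lemma isGreatest_llt₁ {N M : ℕ} [NeZero N] {x : Fin N → ℝ} {s : Fin M → ℝ} (hx : StrictMono x)
    (hs : StrictMono s) (h : Fin N → ℝ) (j : Fin M) :
    IsGreatest (Set.range fun k => s j * x k - h k) ((llt₁ x s h).val j) := by
  obtain ⟨h₁, h₂, h₃⟩ := hull_spec h hx
  have key := (foldl_slopeStep s (Set.range fun k => (x k, h k)) (Set.range_nonempty _)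
    (List.finRange M).reverse
    (List.pairwise_reverse.2 ((List.pairwise_lt_finRange M).imp fun hij => hs hij))
    (hull x h).val (fun _ => 0) h₁ (fun q hq => by
      obtain ⟨k, rfl⟩ := h₂ q hq
      exact ⟨k, rfl⟩)
    (by rintro j - _ ⟨k, rfl⟩; exact h₃ k (s j))).1 j (by simp)
  rw [← Set.range_comp] at key
  have hv : (llt₁ x s h).val =
      ((List.finRange M).reverse.foldl (slopeStep s) ((hull x h).val, fun _ => 0)).2 := by
    simp only [llt₁, val_bind, val_pure, val_loop]
    rfl
  rw [hv]
  exact key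

lemma cost_topGain_le (s : ℝ) (l : List (ℝ × ℝ)) : (topGain s l).cost ≤ 2 := by
  cases l <;> simp [topGain]

lemma cost_llt₁_le {N M : ℕ} (x : Fin N → ℝ) (s : Fin M → ℝ) (h : Fin N → ℝ) :
    (llt₁ x s h).cost ≤ 19 * N + 12 * M + 3 := by
  have h₁ := cost_hull_le x h
  have h₂ := cost_fill_le (fun _ : Fin M => (pure Scalar.zero : Timed ℝ)) 0 (by simp)
  have h₃ := cost_loop_add_le (fun (st : List (ℝ × ℝ) × (Fin M → ℝ)) j => do
      let sj ← rd s j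
      let l' ← advance sj st.1
      let v ← topGain sj l'
      let out' ← wr st.2 j v
      return (l', out')) (fun st => 6 * st.1.length) 10 (fun st j => by
        have h₄ := cost_advance_le (s j) st.1
        have h₅ := cost_topGain_le (s j) (advance (s j) st.1).val
        simp only [cost_bind, cost_rd, val_rd, val_bind, cost_wr, cost_pure, val_pure]
        omega) (List.finRange M).reverse
      ((hull x h).val, (fill (fun _ : Fin M => (pure Scalar.zero : Timed ℝ))).val)
  simp only [llt₁, cost_bind, cost_pure]
  simp only [Fintype.card_fin, List.length_reverse, List.length_finRange] at h₂ h₃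
  omega

/-! ### Sums, products and sizes of grids -/

variable {n m : ℕ} {N : Fin n → ℕ} {M : Fin m → ℕ} {W : ℕ}

lemma foldl_add_eq {ι : Type} (f : ι → ℝ) (l : List ι) (a : ℝ) :
    l.foldl (fun s i => s + f i) a = a + (l.map f).sum := by
  induction l generalizing a with
  | nil => simp
  | cons i l ih => simp [ih, add_assoc]

lemma foldl_mul_eq {ι : Type} (f : ι → ℝ) (l : List ι) (a : ℝ) :
    l.foldl (fun s i => s * f i) a = a * (l.map f).prod := by
  induction l generalizing a with
  | nil => simp
  | cons i l ih => simp [ih, mul_assoc]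

lemma sum_finRange_map (f : Fin n → ℝ) : ((List.finRange n).map f).sum = ∑ i, f i := by
  rw [← List.ofFn_eq_map, List.sum_ofFn]

lemma prod_finRange_map (f : Fin n → ℝ) : ((List.finRange n).map f).prod = ∏ i, f i := by
  rw [← List.ofFn_eq_map, List.prod_ofFn]

lemma card_idx (N : Fin n → ℕ) : Fintype.card (Idx N) = size N := by simp [size]

lemma size_pos (N : Fin n → ℕ) [∀ i, NeZero (N i)] : 0 < size N :=
  Finset.prod_pos fun i _ => NeZero.pos (N i)

lemma le_size (N : Fin n → ℕ) [∀ i, NeZero (N i)] (i : Fin n) : N i ≤ size N :=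
  Finset.single_le_prod' (fun _ _ => NeZero.one_le) (Finset.mem_univ i)

/-- The lines of a grid in direction `i` partition it. -/
lemma card_lines (N : Fin n → ℕ) (i : Fin n) :
    Fintype.card (∀ j : {j // j ≠ i}, Fin (N j)) * N i = size N := by
  rw [← card_idx, Fintype.card_congr (Equiv.piSplitAt i fun j => Fin (N j)), Fintype.card_prod,
    Fintype.card_fin, mul_comm]

/-! ### The transform in several dimensions -/

@[simp] lemma val_negTab (T : Tab ℝ N) : (negTab T).val = -T := by
  ext k
  simp [negTab]

lemma cost_negTab_le (T : Tab ℝ N) : (negTab T).cost ≤ 1 + size N * 3 := by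
  rw [← card_idx]
  exact cost_fill_le _ 2 fun k => le_rfl

lemma piSplitAt_symm_eq_update (j : Idx N) (i : Fin n) (k : Fin (N i)) :
    (Equiv.piSplitAt i fun l => Fin (N l)).symm (k, fun l => j l) = Function.update j i k := by
  ext l
  by_cases h : l = i
  · subst h; simp
  · simp [h]

lemma isGreatest_lltDim [∀ i, NeZero (N i)] {x y : Coords ℝ N} (hx : Sorted x) (hy : Sorted y)
    (i : Fin n) (T : Tab ℝ N) (j : Idx N) :
    IsGreatest (Set.range fun k => y i (j i) * x i k - T (Function.update j i k))
      ((lltDim x y i T).val j) := by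
  simp only [← piSplitAt_symm_eq_update]
  exact isGreatest_llt₁ (hx i) (hy i) _ (j i)

lemma cost_lltDim_le [∀ i, NeZero (N i)] (x y : Coords ℝ N) (i : Fin n) (T : Tab ℝ N) :
    (lltDim x y i T).cost ≤ 1 + 35 * size N := by
  have h₁ : (lltDim x y i T).cost ≤
      1 + Fintype.card (∀ j : {j // j ≠ i}, Fin (N j)) * ((19 * N i + 12 * N i + 3) + 1) :=
    cost_fill_le _ _ fun r => cost_llt₁_le _ _ _
  have h₂ : 1 ≤ N i := NeZero.one_le
  have h₃ := Nat.mul_le_mul_left (Fintype.card (∀ j : {j // j ≠ i}, Fin (N j)))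
    (show (19 * N i + 12 * N i + 3) + 1 ≤ N i * 35 by omega)
  rw [← mul_assoc, card_lines] at h₃
  omega

/-- The transform after the dimensions in `l` have been processed: a maximum over the entries of
the multi-index in those dimensions, the other entries being fixed. -/
lemma isGreatest_foldl_lltDim [∀ i, NeZero (N i)] {x y : Coords ℝ N} (hx : Sorted x)
    (hy : Sorted y) (l : List (Fin n)) (hl : l.Nodup) (A : Tab ℝ N) (j : Idx N) :
    IsGreatest (Set.range fun k : Idx N =>
        (l.map fun i => x i (k i) * y i (j i)).sum + A (fun i => if i ∈ l then k i else j i))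
      (l.foldl (fun A i => (lltDim x y i (-A)).val) A j) := by
  induction l generalizing A with
  | nil => simp
  | cons i l ih =>
    rw [List.nodup_cons] at hl
    have hmix : ∀ (k : Idx N) (a : Fin (N i)),
        Function.update (fun i => if i ∈ l then k i else j i) i a =
          fun i' => if i' ∈ i :: l then Function.update k i a i' else j i' := by
      intro k a
      ext i'
      by_cases h : i' = i
      · subst h; simp
      · simp [h]
    obtain ⟨⟨k, hk⟩, hu⟩ := ih hl.2 (lltDim x y i (-A)).val
    have hA := fun k : Idx N =>
      isGreatest_lltDim hx hy i (-A) (fun i => if i ∈ l then k i else j i)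
    simp only [hl.1, if_false, hmix, Pi.neg_apply, sub_neg_eq_add] at hA
    rw [List.foldl_cons]
    constructor
    · obtain ⟨a, ha⟩ := (hA k).1
      refine ⟨Function.update k i a, ?_⟩
      dsimp only at ha hk ⊢
      have : (l.map fun i' => x i' (Function.update k i a i') * y i' (j i')) =
          l.map fun i' => x i' (k i') * y i' (j i') :=
        List.map_congr_left fun i' hi' => by
          rw [Function.update_of_ne (ne_of_mem_of_not_mem hi' hl.1)]
      rw [← hk, ← ha, List.map_cons, List.sum_cons, this, Function.update_self]
      ring
    · rintro _ ⟨k, rfl⟩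
      have h₁ := hu ⟨k, rfl⟩
      have h₂ := (hA k).2 ⟨k i, rfl⟩
      simp only [Function.update_eq_self] at h₁ h₂
      simp only [List.map_cons, List.sum_cons]
      linarith

lemma val_llt [∀ i, NeZero (N i)] {x y : Coords ℝ N} (hx : Sorted x) (hy : Sorted y)
    (h : Tab ℝ N) : (llt x y h).val = conj x y h := by
  ext j
  have key := isGreatest_foldl_lltDim hx hy (List.finRange n) (List.nodup_finRange n) (-h) j
  simp only [List.mem_finRange, if_true, sum_finRange_map, Pi.neg_apply, ← sub_eq_add_neg] at key
  have hv : (llt x y h).val j =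
      (List.finRange n).foldl (fun A i => (lltDim x y i (-A)).val) (-h) j := by
    simp only [llt, val_bind, val_loop, val_negTab]
  rw [hv]
  refine key.unique ⟨?_, ?_⟩
  · obtain ⟨k, -, hk⟩ := Finset.exists_mem_eq_sup' (Finset.univ_nonempty (α := Idx N))
      fun k => (∑ i, x i (k i) * y i (j i)) - h k
    exact ⟨k, hk.symm⟩
  · rintro _ ⟨k, rfl⟩
    exact Finset.le_sup' (fun k => (∑ i, x i (k i) * y i (j i)) - h k) (Finset.mem_univ k)

lemma cost_llt_le [∀ i, NeZero (N i)] (x y : Coords ℝ N) (h : Tab ℝ N) :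
    (llt x y h).cost ≤ (41 * n + 5) * size N := by
  have h₁ := cost_negTab_le h
  have h₂ := size_pos N
  have h₃ : (loop (fun A i => do
      let T ← negTab A
      lltDim x y i T) (List.finRange n) (negTab h).val).cost ≤
      (List.finRange n).length * (((1 + size N * 3) + (1 + 35 * size N)) + 1) + 1 :=
    cost_loop_le _ _ (fun A i => add_le_add (cost_negTab_le A) (cost_lltDim_le x y i _)) _ _
  have h₄ := Nat.mul_le_mul_left n
    (show ((1 + size N * 3) + (1 + 35 * size N)) + 1 ≤ 41 * size N by omega)
  rw [List.length_finRange] at h₃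
  have h₅ : (41 * n + 5) * size N = n * (41 * size N) + 5 * size N := by ring
  simp only [llt, cost_bind] at h₃ ⊢
  omega

/-! ### Multilinear interpolation -/

/-- Bisection ends with neighbouring positions and preserves the position of `t` between the values
at the two ends, where the ends of the array count as infinite. -/
lemma bisect_spec {K : ℕ} (c : Fin K → ℝ) (t : ℝ) (d : ℕ) : ∀ lo hi : Fin K,
    hi.val - lo.val = d → lo < hi → (lo.val = 0 ∨ c lo ≤ t) → (hi.val + 1 = K ∨ t < c hi) →
    let b := (bisect c t lo hi).val
    b.1.val + 1 = b.2.val ∧ (b.1.val = 0 ∨ c b.1 ≤ t) ∧ (b.2.val + 1 = K ∨ t < c b.2) := by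
  induction d using Nat.strong_induction_on with
  | _ d ih =>
    intro lo hi hd hlt hlo hhi
    rw [Fin.lt_def] at hlt
    rw [bisect]
    split_ifs with h
    · have hm : (lo.val + hi.val) / 2 < K := by omega
      by_cases hc : c ⟨(lo.val + hi.val) / 2, hm⟩ ≤ t
      · simpa [hc] using ih _ (by simp only; omega) ⟨(lo.val + hi.val) / 2, hm⟩ hi rfl
          (by rw [Fin.lt_def]; simp only; omega) (.inr hc) hhi
      · simpa [hc] using ih _ (by simp only; omega) lo ⟨(lo.val + hi.val) / 2, hm⟩ rfl
          (by rw [Fin.lt_def]; simp only; omega) hlo (.inr (not_le.1 hc))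
    · exact ⟨by simp; omega, hlo, hhi⟩

lemma cost_bisect_le {K : ℕ} (c : Fin K → ℝ) (t : ℝ) (k : ℕ) : ∀ lo hi : Fin K,
    hi.val - lo.val ≤ 2 ^ k → (bisect c t lo hi).cost ≤ 4 * k + 1 := by
  induction k with
  | zero =>
    intro lo hi h
    rw [bisect, dif_neg (by simp at h; omega)]
    simp
  | succ k ih =>
    intro lo hi h
    rw [pow_succ] at h
    rw [bisect]
    split_ifs with hlt
    · have hm : (lo.val + hi.val) / 2 < K := by omega
      by_cases hc : c ⟨(lo.val + hi.val) / 2, hm⟩ ≤ t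
      · have := ih ⟨(lo.val + hi.val) / 2, hm⟩ hi (by simp only; omega)
        simp [hc]; omega
      · have := ih lo ⟨(lo.val + hi.val) / 2, hm⟩ (by simp only; omega)
        simp [hc]; omega
    · simp

lemma cellIdx_eq {K : ℕ} {c : Fin K → ℝ} (hc : StrictMono c) {t : ℝ} {lo hi : Fin K}
    (h : lo.val + 1 = hi.val) (hlo : lo.val = 0 ∨ c lo ≤ t) (hhi : hi.val + 1 = K ∨ t < c hi) :
    cellIdx c t = lo := by
  have : NeZero K := ⟨by have := lo.2; omega⟩
  have hset : {k : Fin K | 0 < k.val ∧ k.val + 1 < K ∧ c k ≤ t} = ↑(Finset.Ioc 0 lo) := by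
    ext k
    simp only [Set.mem_ofPred_eq, Finset.coe_Ioc, Set.mem_Ioc, Fin.lt_def, Fin.le_def,
      Fin.val_zero]
    constructor
    · rintro ⟨h₁, h₂, h₃⟩
      refine ⟨h₁, ?_⟩
      by_contra hk
      have hk' : hi ≤ k := by rw [Fin.le_def]; omega
      rcases hhi with hhi | hhi
      · rw [Fin.le_def] at hk'; omega
      · exact absurd ((hc.monotone hk').trans h₃) (not_le.2 hhi)
    · rintro ⟨h₁, h₂⟩
      refine ⟨h₁, by omega, ?_⟩
      rcases hlo with hlo | hlo
      · omega
      · exact (hc.monotone (Fin.le_def.2 h₂)).trans hlo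
  rw [cellIdx, hset, Set.ncard_coe_finset, Fin.card_Ioc]
  simp

lemma val_bisect {K : ℕ} [NeZero K] {c : Fin K → ℝ} (hc : StrictMono c) (t : ℝ) :
    (bisect c t 0 ⟨K - 1, Nat.sub_one_lt (NeZero.ne K)⟩).val = (cellLo c t, cellHi c t) := by
  have hK : 1 ≤ K := NeZero.one_le
  rcases hK.eq_or_lt with rfl | hK
  · exact Subsingleton.elim _ _
  · obtain ⟨h₁, h₂, h₃⟩ := bisect_spec c t _ 0 ⟨K - 1, Nat.sub_one_lt (NeZero.ne K)⟩ rfl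
      (by rw [Fin.lt_def]; simp; omega) (.inl (by simp)) (.inl (by simp; omega))
    have h₄ := cellIdx_eq hc h₁ h₂ h₃
    have h₅ := (bisect c t 0 ⟨K - 1, Nat.sub_one_lt (NeZero.ne K)⟩).val.2.2
    ext
    · simp only [cellLo, h₄]; omega
    · simp only [cellHi, h₄]; omega

lemma val_locate {K : ℕ} [NeZero K] {c : Fin K → ℝ} (hc : StrictMono c) (t : ℝ) :
    (locate c t).val = ((cellLo c t, cellHi c t), cellPos c t) := by
  simp only [locate, val_bind, val_bisect hc]
  split_ifs with h
  · simp [cellPos, h]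
  · simp [cellPos]

lemma cost_locate_le {K : ℕ} [NeZero K] (c : Fin K → ℝ) (t : ℝ) (k : ℕ) (hk : K ≤ 2 ^ k) :
    (locate c t).cost ≤ 4 * k + 7 := by
  have := cost_bisect_le c t k 0 ⟨K - 1, Nat.sub_one_lt (NeZero.ne K)⟩ (by simp; omega)
  simp only [locate, cost_bind]
  split_ifs <;> simp <;> omega

lemma val_lerp [∀ i, NeZero (N i)] {g : Coords ℝ N} (hg : Sorted g) (T : Tab ℝ N)
    (q : Fin n → ℝ) : (lerp g T q).val = LERP g T q := by
  simp only [lerp, val_bind, val_loop, val_fill, val_rd, val_locate (hg _), LERP]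
  simp only [Scalar.mul_real, Scalar.add_real, Scalar.zero_real]
  rw [foldl_add_eq, Finset.sum_map_toList, zero_add]
  refine Finset.sum_congr rfl fun v _ => congrArg (· * _) ?_
  rw [← prod_finRange_map, ← one_mul (List.prod _), ← foldl_mul_eq]
  congr 1
  ext a i
  split_ifs <;> simp

lemma cost_lerp_le [∀ i, NeZero (N i)] (g : Coords ℝ N) (T : Tab ℝ N) (q : Fin n → ℝ) (k : ℕ)
    (hk : size N ≤ 2 ^ k) :
    (lerp g T q).cost ≤ n * (4 * k + 9) + 2 ^ n * (5 * n + 5) + 2 := by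
  have h₁ : (fill fun i => do
      let t ← rd q i
      locate (g i) t).cost ≤ 1 + Fintype.card (Fin n) * ((1 + (4 * k + 7)) + 1) :=
    cost_fill_le _ _ fun i =>
      Nat.add_le_add_left (cost_locate_le _ _ k ((le_size N i).trans hk)) 1
  rw [Fintype.card_fin] at h₁
  simp only [lerp, cost_bind]
  have h₂ : ∀ (cell : ∀ i, (Fin (N i) × Fin (N i)) × ℝ) (v : Fin n → Bool), (loop (fun a i => do
      let e ← rd cell i
      charge 1
      if v i then Scalar.mul a e.2 else do
        let d ← Scalar.sub Scalar.one e.2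
        Scalar.mul a d) (List.finRange n) (Scalar.one : ℝ)).cost ≤ n * 5 + 1 := by
    intro cell v
    refine (cost_loop_le _ 4 (fun a i => ?_) _ _).trans (by simp)
    simp only [cost_bind, cost_rd, cost_charge]
    split_ifs <;> simp
  refine (add_le_add h₁ (cost_loop_le _ (n * 5 + 4) (fun s v => ?_) _ _)).trans ?_
  · simp only [cost_bind]
    have := h₂ (fill fun i => do
      let t ← rd q i
      locate (g i) t).val v
    refine (Nat.add_le_add_right this _).trans (le_of_eq ?_)
    simp
  · simp
    ring_nf
    omega

/-! ### Extrema of tables -/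

lemma foldl_max_le_iff {ι : Type} (f : ι → ℝ) (l : List ι) (a c : ℝ) :
    l.foldl (fun s i => max s (f i)) a ≤ c ↔ a ≤ c ∧ ∀ i ∈ l, f i ≤ c := by
  induction l generalizing a with
  | nil => simp
  | cons i l ih => simp [ih, and_assoc]

lemma le_foldl_min_iff {ι : Type} (f : ι → ℝ) (l : List ι) (a c : ℝ) :
    c ≤ l.foldl (fun s i => min s (f i)) a ↔ c ≤ a ∧ ∀ i ∈ l, c ≤ f i := by
  induction l generalizing a with
  | nil => simp
  | cons i l ih => simp [ih, and_assoc]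

lemma val_minTab [∀ i, NeZero (N i)] (T : Tab ℝ N) :
    (minTab T).val = Finset.univ.inf' Finset.univ_nonempty T := by
  have hv : (minTab T).val =
      (Finset.univ : Finset (Idx N)).toList.foldl (fun s k => min s (T k)) (T fun _ => 0) := by
    simp only [minTab, val_bind, val_loop, val_rd]
    congr 1
    ext s k
    by_cases h : T k ≤ s
    · simp [h]
    · simp [h, (not_le.1 h).le]
  refine eq_of_forall_le_iff fun c => ?_
  rw [hv, le_foldl_min_iff]
  simp only [Finset.mem_toList, Finset.mem_univ, forall_true_left, Finset.le_inf'_iff]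
  exact and_iff_right_of_imp fun h => h _

lemma cost_minTab_le [∀ i, NeZero (N i)] (T : Tab ℝ N) : (minTab T).cost ≤ size N * 3 + 2 := by
  have h := cost_loop_le (fun (s : ℝ) (k : Idx N) => do
    let t ← rd T k
    let b ← Scalar.le t s
    if b then return t else return s) 2 (fun s k => by
      simp only [cost_bind, cost_rd, Scalar.cost_le_real]
      split_ifs <;> simp) Finset.univ.toList (T fun _ => 0)
  rw [Finset.length_toList, Finset.card_univ, card_idx] at h
  simp only [minTab, cost_bind, cost_rd, val_rd] at h ⊢
  omega

lemma val_distTab (S T : Tab ℝ N) : (distTab S T).val = ‖S - T‖ := by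
  have hv : (distTab S T).val =
      (Finset.univ : Finset (Idx N)).toList.foldl (fun s k => max s ‖(S - T) k‖) 0 := by
    simp only [distTab, val_loop]
    congr 1
    ext s k
    rw [Pi.sub_apply, Real.norm_eq_abs, abs_eq_max_neg, neg_sub, ← max_assoc]
    simp only [val_bind, val_rd, Scalar.sub_real, Scalar.val_le_real]
    by_cases h : s ≤ S k - T k
    · by_cases h' : S k - T k ≤ T k - S k
      · simp [h, h']
      · simp [h, h', (not_le.1 h').le]
    · by_cases h' : s ≤ T k - S k
      · simp [h, h', (not_le.1 h).le]
      · simp [h, h', (not_le.1 h).le, (not_le.1 h').le]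
  refine eq_of_forall_ge_iff fun c => ?_
  rw [hv, foldl_max_le_iff]
  simp only [Finset.mem_toList, Finset.mem_univ, forall_true_left]
  constructor
  · rintro ⟨h₀, h⟩
    exact (pi_norm_le_iff_of_nonneg h₀).2 h
  · intro h
    have h₀ := (norm_nonneg _).trans h
    exact ⟨h₀, (pi_norm_le_iff_of_nonneg h₀).1 h⟩

lemma cost_distTab_le (S T : Tab ℝ N) : (distTab S T).cost ≤ size N * 7 + 1 := by
  rw [← card_idx, ← Finset.card_univ, ← Finset.length_toList]
  refine cost_loop_le _ 6 (fun s k => ?_) _ _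
  simp only [cost_bind, cost_rd, Scalar.cost_le_real, Scalar.sub_real]
  split_ifs <;> simp

/-! ### The initialization -/

lemma val_initialization [∀ j, NeZero (M j)] (I : Input ℝ N M W) (hu : Sorted I.u)
    (hV : Sorted I.mkV.val) : (initialization I).val = initialData I := by
  simp [initialization, initialData, val_llt hu hV, val_minTab]

lemma cost_initialization_le [∀ j, NeZero (M j)] (I : Input ℝ N M W) :
    (initialization I).cost ≤ I.mkV.cost + I.mkZ.cost + I.mkY.cost +
      (41 * m + 8) * size M + 4 * size N + 4 := by
  have h₁ := cost_llt_le I.u I.mkV.val I.Ci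
  have h₂ := cost_minTab_le I.Ci
  have h₃ := cost_fill_le (fun _ : Idx N => (pure Scalar.zero : Timed ℝ)) 0 (by simp)
  have h₄ := cost_fill_le (fun k : Idx N => do
    let c ← rd I.Cs k
    Scalar.sub c (minTab I.Ci).val) 2 (by simp)
  rw [card_idx] at h₃ h₄
  have h₅ : (41 * m + 8) * size M = (41 * m + 5) * size M + size M * 3 := by ring
  simp only [initialization, cost_bind, cost_pure] at h₃ h₄ ⊢
  omega

/-! ### The iteration -/

lemma val_expectation (I : Input ℝ N M W) (J : Tab ℝ N) :
    (expectation I J).val = fun k =>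
      I.γ * ∑ l, I.p l * (I.ext J (fun i => I.x i (k i) + I.w l i)).val := by
  ext k
  simp only [expectation, val_fill, val_bind, val_loop, val_rd, Scalar.add_real, Scalar.mul_real,
    Scalar.zero_real]
  rw [foldl_add_eq, sum_finRange_map, zero_add]

lemma cost_expectation_le (I : Input ℝ N M W) (J : Tab ℝ N) (e : ℕ)
    (he : ∀ (k : Idx N) (l : Fin W), (I.ext J (fun i => I.x i (k i) + I.w l i)).cost ≤ e) :
    (expectation I J).cost ≤ 1 + size N * (W * (4 * n + 5 + e) + 3) := by
  rw [← card_idx]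
  refine cost_fill_le _ (W * (4 * n + 5 + e) + 2) fun k => ?_
  have h := cost_loop_le (fun (s : ℝ) (l : Fin W) => do
      let q ← fill (fun i => do
        let a ← rd (I.x i) (k i)
        let b ← rd (I.w l) i
        Scalar.add a b)
      let e ← I.ext J q
      let pl ← rd I.p l
      let t ← Scalar.mul pl e
      Scalar.add s t) (4 * n + 4 + e) (fun s l => by
    have h₁ := cost_fill_le (fun i => do
        let a ← rd (I.x i) (k i)
        let b ← rd (I.w l) i
        Scalar.add a b) 3 (by simp)
    have h₂ := he k l
    simp only [cost_bind, val_fill, val_bind, val_rd, Scalar.add_real, Scalar.mul_real, cost_rd,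
      Fintype.card_fin] at h₁ ⊢
    omega) (List.finRange W) Scalar.zero
  rw [List.length_finRange] at h
  simp only [cost_bind, Scalar.mul_real] at h ⊢
  linarith

lemma val_negTransposeMul (B : Matrix (Fin n) (Fin m) ℝ) (y : Fin n → ℝ) :
    (negTransposeMul B y).val = -(B.transpose.mulVec y) := by
  ext j
  simp only [negTransposeMul, val_fill, val_bind, val_loop, val_rd, Scalar.sub_real,
    Scalar.mul_real, Scalar.zero_real, sub_eq_add_neg]
  rw [foldl_add_eq, sum_finRange_map, zero_add]
  simp [Matrix.mulVec, dotProduct]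

lemma cost_negTransposeMul_le (B : Matrix (Fin n) (Fin m) ℝ) (y : Fin n → ℝ) :
    (negTransposeMul B y).cost ≤ 1 + m * (n * 5 + 2) := by
  have h := cost_fill_le (fun j => loop (fun (s : ℝ) i => do
    let b ← rd (B i) j
    let a ← rd y i
    let t ← Scalar.mul b a
    Scalar.sub s t) (List.finRange n) Scalar.zero) (n * 5 + 1) (fun j => by
      refine (cost_loop_le _ 4 (fun s i => ?_) _ _).trans (by simp)
      simp)
  rwa [Fintype.card_fin] at h

@[simp] lemma val_pointAt (g : Coords ℝ N) (k : Idx N) :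
    (pointAt g k).val = fun i => g i (k i) := rfl

lemma cost_pointAt_le (g : Coords ℝ N) (k : Idx N) : (pointAt g k).cost ≤ 1 + n * 2 := by
  have h := cost_fill_le (fun i => rd (g i) (k i)) 1 (by simp)
  rwa [Fintype.card_fin] at h

section Body

variable [∀ i, NeZero (N i)] [∀ j, NeZero (M j)]

lemma val_body (I : Input ℝ N M W) (st : LoopState ℝ N) (hx : Sorted I.x)
    (hY : Sorted I.mkY.val) (hZ : Sorted I.mkZ.val) (hV : Sorted I.mkV.val) :
    (body I (initialData I).1 st).val =
      ⟨st.Jplus, dCDP I I.mkY.val I.mkZ.val I.mkV.val st.Jplus⟩ := by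
  simp only [body, initialData, val_bind, val_fill, val_rd, val_pure, val_expectation,
    val_llt hx hY, val_llt hY hZ, val_lerp hV, val_lerp hZ, val_negTransposeMul, val_pointAt,
    Scalar.add_real, dCDP]

lemma cost_body_le (I : Input ℝ N M W) (S : Setup ℝ N M) (st : LoopState ℝ N) (e f k : ℕ)
    (he : ∀ (J : Tab ℝ N) (k : Idx N) (l : Fin W),
      (I.ext J (fun i => I.x i (k i) + I.w l i)).cost ≤ e)
    (hf : ∀ q, (I.fs q).cost ≤ f) (hN : size N ≤ 2 ^ k) (hM : size M ≤ 2 ^ k) :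
    (body I S st).cost ≤ size N * (W * (4 * n + 5 + e) + f + 4 * (m + n) * k +
      (95 * n + 5 * (n * m) + 11 * m + 2 ^ m * (5 * m + 5) + 2 ^ n * (5 * n + 5) + 40)) := by
  have hpos := size_pos N
  set X := size N with hX
  have h₁ : (fill fun k => rd st.Jplus k).cost ≤ 1 + X * 2 := by
    rw [hX, ← card_idx]
    exact cost_fill_le _ 1 (by simp)
  have h₂ := fun J => cost_expectation_le I J e (he J)
  have h₃ := fun h => cost_llt_le I.x S.Y h
  have h₄ := fun h => cost_llt_le S.Y S.Z h
  have h₅ : ∀ T : Tab ℝ N, (fill fun k => do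
      let y ← pointAt S.Y k
      let v ← negTransposeMul I.B y
      let c ← lerp S.V S.CiConj v
      let e ← rd T k
      Scalar.add c e).cost ≤ 1 + X * ((1 + n * 2) + ((1 + m * (n * 5 + 2)) +
        ((m * (4 * k + 9) + 2 ^ m * (5 * m + 5) + 2) + (1 + 1))) + 1) := by
    intro T
    rw [hX, ← card_idx]
    exact cost_fill_le _ _ fun j => add_le_add (cost_pointAt_le _ _)
      (add_le_add (cost_negTransposeMul_le _ _) (add_le_add (cost_lerp_le _ _ _ k hM) le_rfl))
  have h₆ : ∀ T : Tab ℝ N, (fill fun k => do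
      let x ← pointAt I.x k
      let z ← I.fs x
      let t ← lerp S.Z T z
      let c ← rd I.Cs k
      Scalar.add c t).cost ≤ 1 + X * ((1 + n * 2) + (f +
        ((n * (4 * k + 9) + 2 ^ n * (5 * n + 5) + 2) + (1 + 1))) + 1) := by
    intro T
    rw [hX, ← card_idx]
    exact cost_fill_le _ _ fun j => add_le_add (cost_pointAt_le _ _)
      (add_le_add (hf _) (add_le_add (cost_lerp_le _ _ _ k hN) le_rfl))
  refine (add_le_add h₁ (add_le_add (h₂ _) (add_le_add (h₃ _) (add_le_add (h₅ _)
    (add_le_add (h₄ _) (add_le_add (h₆ _) le_rfl)))))).trans ?_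
  rw [← hX, cost_pure]
  nlinarith

lemma val_iteration (I : Input ℝ N M W) (st : LoopState ℝ N) (hx : Sorted I.x)
    (hY : Sorted I.mkY.val) (hZ : Sorted I.mkZ.val) (hV : Sorted I.mkV.val) :
    (iteration I (initialData I).1 st).val =
      if I.et ≤ ‖st.Jplus - st.J‖ then
        Sum.inl ⟨st.Jplus, dCDP I I.mkY.val I.mkZ.val I.mkV.val st.Jplus⟩
      else Sum.inr st.Jplus := by
  simp only [iteration, val_bind, val_distTab, Scalar.val_le_real]
  split_ifs
  · rw [val_bind, val_body I st hx hY hZ hV, val_pure]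
  · rw [val_pure]

lemma cost_iteration_le (I : Input ℝ N M W) (S : Setup ℝ N M) (st : LoopState ℝ N) :
    (iteration I S st).cost ≤ 9 * size N + (body I S st).cost := by
  have h₁ := cost_distTab_le st.Jplus st.J
  have h₂ := size_pos N
  simp only [iteration, cost_bind, Scalar.cost_le_real]
  split_ifs <;> simp <;> omega

end Body

end ConjVI

open ConjVI in
theorem theorem2 (n m : ℕ) (K : ℝ) :
    ∃ C : ℝ, ∀ (N : Fin n → ℕ) (M : Fin m → ℕ) (W : ℕ)
      [∀ i, NeZero (N i)] [∀ j, NeZero (M j)] [NeZero W] (I : Input ℝ N M W) (E : ℝ),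
      Sorted I.x → Sorted I.u →
      Sorted I.mkY.val → Sorted I.mkZ.val → Sorted I.mkV.val →
      (I.mkY.cost : ℝ) ≤ K * (size N + size M) →
      (I.mkZ.cost : ℝ) ≤ K * (size N + size M) →
      (I.mkV.cost : ℝ) ≤ K * (size N + size M) →
      (∀ q, ((I.fs q).cost : ℝ) ≤ K) →
      1 ≤ E →
      (∀ (J : Tab ℝ N) (k : Idx N) (l : Fin W),
        ((I.ext J (fun i => I.x i (k i) + I.w l i)).cost : ℝ) ≤ K * E) →
      ((initialization I).val = initialData I ∧
        ((initialization I).cost : ℝ) ≤ C * (size N + size M)) ∧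
      ∀ st : LoopState ℝ N,
        (iteration I (initialization I).val.1 st).val =
            (if I.et ≤ ‖st.Jplus - st.J‖ then
              Sum.inl ⟨st.Jplus, dCDP I I.mkY.val I.mkZ.val I.mkV.val st.Jplus⟩
            else Sum.inr st.Jplus) ∧
        ((iteration I (initialization I).val.1 st).cost : ℝ) ≤
          C * (size N * W * E * Real.log (size N + size M)) := by
  set c : ℕ := 95 * n + 5 * (n * m) + 11 * m + 2 ^ m * (5 * m + 5) + 2 ^ n * (5 * n + 5) + 49
    with hc
  -- the larger of the constants that the two parts need
  refine ⟨max (3 * K + 41 * m + 16) (2 * (4 * n + 5 + K) + 2 * K + 16 * (m + n) + 2 * c), ?_⟩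
  intro N M W _ _ _ I E hx hu hY hZ hV hcY hcZ hcV hf hE he
  have hX : (1 : ℝ) ≤ size N := by exact_mod_cast size_pos N
  have hU : (1 : ℝ) ≤ size M := by exact_mod_cast size_pos M
  have hK : 0 ≤ K := (Nat.cast_nonneg _).trans (hf 0)
  have hW : (1 : ℝ) ≤ W := by exact_mod_cast NeZero.one_le (n := W)
  rw [val_initialization I hu hV]
  refine ⟨⟨rfl, ?_⟩, fun st => ⟨val_iteration I st hx hY hZ hV, ?_⟩⟩
  · have h : ((initialization I).cost : ℝ) ≤ I.mkV.cost + I.mkZ.cost + I.mkY.cost +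
        (41 * m + 8) * size M + 4 * size N + 4 := by
      exact_mod_cast cost_initialization_le I
    refine le_trans ?_ (mul_le_mul_of_nonneg_right (le_max_left _ _) (by positivity))
    have : 0 ≤ (m : ℝ) * size N := by positivity
    nlinarith
  · -- `2 ^ k` exceeds the sizes of the grids, so that `k` halvings end each bisection
    set k := Nat.log 2 (size N + size M) + 1 with hk
    have hlt : size N + size M < 2 ^ k := Nat.lt_pow_succ_log_self one_lt_two _
    have h := (cost_iteration_le I (initialData I).1 st).trans (Nat.add_le_add_left
      (cost_body_le I (initialData I).1 st ⌊K * E⌋₊ ⌊K⌋₊ k (fun J k l => Nat.le_floor (he J k l))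
        (fun q => Nat.le_floor (hf q)) (by omega) (by omega)) _)
    rw [← Nat.cast_le (α := ℝ)] at h
    set Λ := Real.log (size N + size M) with hΛ
    have hlog2 : 1 / 2 < Real.log 2 := by linarith [Real.log_two_gt_d9]
    have hΛ₁ : 1 ≤ 2 * Λ := by
      have : Real.log 2 ≤ Λ := Real.log_le_log two_pos (by linarith)
      linarith
    have hkΛ : (k : ℝ) ≤ 4 * Λ := by
      have h₁ : ((2 : ℝ) ^ Nat.log 2 (size N + size M)) ≤ size N + size M := by
        exact_mod_cast Nat.pow_log_le_self 2 (by have := size_pos N; omega)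
      have h₂ := Real.log_le_log (by positivity) h₁
      rw [Real.log_pow] at h₂
      have h₃ : (Nat.log 2 (size N + size M) : ℝ) * (1 / 2) ≤
          Nat.log 2 (size N + size M) * Real.log 2 :=
        mul_le_mul_of_nonneg_left hlog2.le (Nat.cast_nonneg _)
      rw [hk]
      push_cast
      linarith
    have hKE : (⌊K * E⌋₊ : ℝ) ≤ K * E := Nat.floor_le (by positivity)
    have hKf : (⌊K⌋₊ : ℝ) ≤ K := Nat.floor_le hK
    have hWE : 1 ≤ W * E := one_le_mul_of_one_le_of_one_le hW hE
    have hsum : (9 : ℝ) + (W * (4 * n + 5 + ⌊K * E⌋₊) + ⌊K⌋₊ + 4 * (m + n) * k + (c - 9)) ≤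
        (2 * (4 * n + 5 + K) + 2 * K + 16 * (m + n) + 2 * c) * (W * E * Λ) := by
      have h₁ : W * (4 * n + 5 + ⌊K * E⌋₊) ≤ (4 * n + 5 + K) * (W * E) := by
        have : (4 * n + 5 + ⌊K * E⌋₊ : ℝ) ≤ (4 * n + 5 + K) * E := by
          nlinarith [mul_nonneg (Nat.cast_nonneg (α := ℝ) n) (sub_nonneg.2 hE)]
        calc _ ≤ (W : ℝ) * ((4 * n + 5 + K) * E) := by gcongr
          _ = _ := by ring
      have h₂ : (4 * n + 5 + K) * (W * E) * 1 ≤ (4 * n + 5 + K) * (W * E) * (2 * Λ) := by gcongr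
      have h₃ : 1 ≤ W * E * (2 * Λ) := one_le_mul_of_one_le_of_one_le hWE hΛ₁
      have h₄ : (K + c) * 1 ≤ (K + c) * (W * E * (2 * Λ)) := by gcongr
      have h₅ : (4 * (m + n) * k : ℝ) ≤ 16 * (m + n) * (W * E * Λ) := by
        calc (4 * (m + n) * k : ℝ) ≤ 4 * (m + n) * (1 * (4 * Λ)) := by rw [one_mul]; gcongr
          _ ≤ 4 * (m + n) * (W * E * (4 * Λ)) := by gcongr; linarith
          _ = _ := by ring
      linarith
    calc ((iteration I (initialData I).1 st).cost : ℝ)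
        ≤ size N *
          (9 + (W * (4 * n + 5 + ⌊K * E⌋₊) + ⌊K⌋₊ + 4 * (m + n) * k + (c - 9))) := by
          refine h.trans (le_of_eq ?_)
          rw [hc]
          push_cast
          ring
      _ ≤ size N * ((2 * (4 * n + 5 + K) + 2 * K + 16 * (m + n) + 2 * c) * (W * E * Λ)) := by
          gcongr
      _ = (2 * (4 * n + 5 + K) + 2 * K + 16 * (m + n) + 2 * c) * (size N * W * E * Λ) := by ring
      _ ≤ _ := mul_le_mul_of_nonneg_right (le_max_right _ _) (by
          have : 0 ≤ Λ := by linarith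
          positivity)
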